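/- Let $X$ be a finite connected CW complex of dimension $d\ge 1$, with set of $k$-cells $X_k$ (each cell oriented). Let $C_k(X;R)$, with basis $X_k$, be its cellular chain groups, $Z_k$, $B_k$, $H_k$ the cycles, boundaries and cellular homology, and $\beta_k(\cdot)=\dim_{\mathbb R}H_k(\cdot;\mathbb R)$. Give $C_k(X;\mathbb R)$ the inner product for which $X_k$ is an orthonormal basis. A spanning tree of $X$ is a subcomplex $T\subset X$ containing the $(d-1)$-skeleton of $X$ such that $H_d(T;\mathbb Z)=0$ and $\beta_{d-1}(T)=\beta_{d-1}(X)$; there are finitely many of them, and all sums below run over all spanning trees $T$ of $X$. Fix $W\colon X_d\to\mathbb R$ and let $e^{-W}$ be the operator $b\mapsto e^{-W_b}b$ on $d$-chains. For $T=X$ or $T$ a spanning tree, let $\partial_T\colon C_d(T;\mathbb R)\to C_{d-1}(T;\mathbb R)=C_{d-1}(X;\mathbb R)$ be the boundary operator, $\partial_T^*$ its adjoint, and $$\mathcal L^T=\partial_T e^{-W}\partial_T^*\colon B_{d-1}(T;\mathbb R)\to B_{d-1}(T;\mathbb R),\qquad \mathcal L=\mathcal L^X .$$ Let $A\subset C_{d-1}(X;\mathbb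 Z)$ be a subgroup, with real span $A_{\mathbb R}\subset C_{d-1}(X;\mathbb R)$, such that the orthogonal projection $B_{d-1}(X;\mathbb R)\to A_{\mathbb R}$ is induced by a homomorphism $p_A\colon B_{d-1}(X;\mathbb Z)\to A$ for which $p_A\otimes\mathbb R$ is an isomorphism. Let $P_A$ be the orthogonal projection onto $A_{\mathbb R}$ and put $$\mathcal L_A^T=P_A\,\partial_T e^{-W}\partial_T^*|_{A_{\mathbb R}}\colon A_{\mathbb R}\to A_{\mathbb R},\qquad \mathcal L_A=\mathcal L_A^X .$$ Then $$\det\mathcal L_A=\sum_T\det\mathcal L_A^T .$$ In particular (the case $A=B_{d-1}(X;\mathbb Z)$), $$\det\mathcal L=\sum_T\det\mathcal L^T ,$$ and in the unweighted case $W=0$ moreover $$\det\mathcal L=\sum_T\det\mathcal L^T=\sum_T\mu_T ,$$ where $\mu_T=\det(\langle e_i,e_j\rangle)_{i,j}$ for a $\mathbb Z$-basis $(e_i)$ of $B_{d-1}(T;\mathbb Z)$, i.e. the squared covolume of the lattice $B_{d-1}(T;\mathbb Z)$ in $B_{d-1}(T;\mathbb R)$. -/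

import Mathlib

open CategoryTheory Topology Metric

universe u

namespace CellTree

/-! ### Relative singular homology of pairs of subsets of a space -/

section Singular

variable {Y Z : Type u} [TopologicalSpace Y] [TopologicalSpace Z]

/-- The singular chain complex of `Y` with integer coefficients. -/
noncomputable abbrev sing (Y : Type u) [TopologicalSpace Y] : ChainComplex AddCommGrpCat.{u} ℕ :=
  ((AlgebraicTopology.singularChainComplexFunctor AddCommGrpCat.{u}).obj
    (AddCommGrpCat.of (ULift.{u} ℤ))).obj (TopCat.of Y)

/-- The chain map induced by a continuous map. -/
noncomputable abbrev singMap (f : C(Y, Z)) : sing Y ⟶ sing Z :=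
  ((AlgebraicTopology.singularChainComplexFunctor AddCommGrpCat.{u}).obj
    (AddCommGrpCat.of (ULift.{u} ℤ))).map (TopCat.ofHom f)

/-- The boundary operator `∂ : S_k(Y) → S_j(Y)`; it is zero unless `k = j + 1`. -/
noncomputable abbrev singD (Y : Type u) [TopologicalSpace Y] (k j : ℕ) :
    (sing Y).X k →+ (sing Y).X j :=
  ((sing Y).d k j).hom

/-- The map `S_k(Y) → S_k(Z)` induced by a continuous map. -/
noncomputable abbrev singF (f : C(Y, Z)) (k : ℕ) : (sing Y).X k →+ (sing Z).X k :=
  ((singMap f).f k).hom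

/-- The inclusion of a subset as a continuous map. -/
def incl (U : Set Y) : C(U, Y) := ⟨Subtype.val, continuous_subtype_val⟩

/-- The singular chains of `Y` that lie in the subset `U`, i.e. `S_k(U) ⊆ S_k(Y)`. -/
noncomputable def chainsIn (U : Set Y) (k : ℕ) : AddSubgroup ((sing Y).X k) :=
  (singF (incl U) k).range

lemma singF_singD (f : C(Y, Z)) (k j : ℕ) (c : (sing Y).X k) :
    singD Z k j (singF f k c) = singF f j (singD Y k j c) :=
  congrArg (fun φ => φ.hom c) ((singMap f).comm k j)

lemma singD_singD (i j k : ℕ) (c : (sing Y).X i) : singD Y j k (singD Y i j c) = 0 :=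
  congrArg (fun φ => φ.hom c) ((sing Y).d_comp_d i j k)

lemma singF_chainsIn (f : C(Y, Z)) {U : Set Y} {U' : Set Z} (h : Set.MapsTo f U U') {k : ℕ}
    {c : (sing Y).X k} (hc : c ∈ chainsIn U k) : singF f k c ∈ chainsIn U' k := by
  obtain ⟨e, rfl⟩ := hc
  let g : C(U, U') := ⟨h.restrict, f.continuous.restrict h⟩
  refine ⟨singF g k e, ?_⟩
  have h1 : singMap g ≫ singMap (incl U') = singMap (incl U) ≫ singMap f := by
    rw [← Functor.map_comp, ← Functor.map_comp]
    rfl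
  have h2 := congrArg (fun φ => φ.f k) h1
  exact congrArg (fun φ => φ.hom e) h2

/-- Relative cycles: chains in `U` whose boundary lies in `V`
(for `k = 0` the boundary is zero and the condition is void). -/
noncomputable def relCycles (U V : Set Y) (k : ℕ) : AddSubgroup ((sing Y).X k) :=
  chainsIn U k ⊓ (chainsIn V (k - 1)).comap (singD Y k (k - 1))

/-- Relative boundaries: boundaries of chains in `U`, plus chains in `V`. -/
noncomputable def relBoundaries (U V : Set Y) (k : ℕ) : AddSubgroup ((sing Y).X k) :=
  (chainsIn U (k + 1)).map (singD Y (k + 1) k) ⊔ chainsIn V k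

/-- The relative singular homology `H_k(U, V; ℤ)` for `V ⊆ U ⊆ Y`. -/
abbrev RelHomology (U V : Set Y) (k : ℕ) : Type u :=
  relCycles U V k ⧸ (relBoundaries U V k).addSubgroupOf (relCycles U V k)

lemma singF_relCycles (f : C(Y, Z)) {U V : Set Y} {U' V' : Set Z} (hU : Set.MapsTo f U U')
    (hV : Set.MapsTo f V V') (k : ℕ) {c : (sing Y).X k} (hc : c ∈ relCycles U V k) :
    singF f k c ∈ relCycles U' V' k := by
  refine AddSubgroup.mem_inf.2 ⟨singF_chainsIn f hU hc.1, ?_⟩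
  rw [AddSubgroup.mem_comap, singF_singD]
  exact singF_chainsIn f hV hc.2

lemma singF_relBoundaries (f : C(Y, Z)) {U V : Set Y} {U' V' : Set Z} (hU : Set.MapsTo f U U')
    (hV : Set.MapsTo f V V') (k : ℕ) {c : (sing Y).X k} (hc : c ∈ relBoundaries U V k) :
    singF f k c ∈ relBoundaries U' V' k := by
  obtain ⟨_, ⟨e, he, rfl⟩, v, hv, rfl⟩ := AddSubgroup.mem_sup.1 hc
  rw [map_add, ← singF_singD]
  exact AddSubgroup.add_mem_sup ⟨_, singF_chainsIn f hU he, rfl⟩ (singF_chainsIn f hV hv)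

/-- The map `H_k(U, V) → H_k(U', V')` induced by a continuous map of pairs. -/
noncomputable def relMap (f : C(Y, Z)) {U V : Set Y} {U' V' : Set Z} (hU : Set.MapsTo f U U')
    (hV : Set.MapsTo f V V') (k : ℕ) : RelHomology U V k →+ RelHomology U' V' k :=
  QuotientAddGroup.map _ _
    (((singF f k).comp (relCycles U V k).subtype).codRestrict (relCycles U' V' k)
      fun c => singF_relCycles f hU hV k c.2)
    fun _ hc => singF_relBoundaries f hU hV k hc

lemma singD_relCycles {U V : Set Y} (W : Set Y) (k : ℕ) {c : (sing Y).X (k + 1)}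
    (hc : c ∈ relCycles U V (k + 1)) : singD Y (k + 1) k c ∈ relCycles V W k := by
  refine AddSubgroup.mem_inf.2 ⟨hc.2, ?_⟩
  rw [AddSubgroup.mem_comap, singD_singD]
  exact zero_mem _

lemma singD_relBoundaries {U V : Set Y} (W : Set Y) (k : ℕ) {c : (sing Y).X (k + 1)}
    (hc : c ∈ relBoundaries U V (k + 1)) : singD Y (k + 1) k c ∈ relBoundaries V W k := by
  obtain ⟨_, ⟨e, -, rfl⟩, v, hv, rfl⟩ := AddSubgroup.mem_sup.1 hc
  rw [map_add, singD_singD, zero_add]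
  exact AddSubgroup.mem_sup_left ⟨v, hv, rfl⟩

/-- The connecting map `H_{k+1}(U, V) → H_k(V, W)`, `[c] ↦ [∂c]`, of a triple `W ⊆ V ⊆ U`. -/
noncomputable def relConnecting (U V W : Set Y) (k : ℕ) :
    RelHomology U V (k + 1) →+ RelHomology V W k :=
  QuotientAddGroup.map _ _
    (((singD Y (k + 1) k).comp (relCycles U V (k + 1)).subtype).codRestrict (relCycles V W k)
      fun c => singD_relCycles W k c.2)
    fun _ hc => singD_relBoundaries W k hc

end Singular

/-! ### The cellular chain complex of a finite CW complex -/

section Cellular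

/-- The closed disk `D^k`, the domain of the characteristic maps of the `k`-cells. -/
abbrev Disk (k : ℕ) : Type u := ULift.{u} (closedBall (0 : Fin k → ℝ) 1)

/-- The boundary sphere `S^{k-1} ⊆ D^k`. -/
def diskSphere (k : ℕ) : Set (Disk.{u} k) := {x | (x.down : Fin k → ℝ) ∈ sphere 0 1}

variable {X : Type u} [TopologicalSpace X] (C : Set X) [CWComplex C]

/-- An orientation of the cells: for every `k`-cell a generator of `H_k(D^k, S^{k-1}; ℤ) ≅ ℤ`,
where `D^k` is the domain of the characteristic map of the cell. -/
structure CellOrientation where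
  gen (k : ℕ) (i : RelCWComplex.cell C k) :
    RelHomology (Set.univ : Set (Disk.{u} k)) (diskSphere k) k
  zmultiples_gen (k : ℕ) (i : RelCWComplex.cell C k) : AddSubgroup.zmultiples (gen k i) = ⊤

/-- A finite CW complex has finitely many cells in each dimension. -/
noncomputable instance cellFintype [RelCWComplex.FiniteType C] (k : ℕ) :
    Fintype (RelCWComplex.cell C k) :=
  @Fintype.ofFinite _ (RelCWComplex.FiniteType.finite_cell (C := C) k)

noncomputable instance cellDecidableEq (k : ℕ) : DecidableEq (RelCWComplex.cell C k) :=
  Classical.decEq _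

variable {C}

/-- The characteristic map `D^k → X` of a `k`-cell. -/
def charMap {k : ℕ} (i : RelCWComplex.cell C k) : C(Disk.{u} k, X) where
  toFun x := RelCWComplex.map k i x.down
  continuous_toFun :=
    (continuousOn_iff_continuous_domRestrict.1 (RelCWComplex.continuousOn k i)).comp
      continuous_uliftDown

variable [T2Space X]

variable (C) in
/-- The cellular chain group `H_k(X^(k), X^(k-1); ℤ)`. -/
abbrev CellHomology (k : ℕ) : Type u :=
  RelHomology (CWComplex.skeletonLT C (k + 1 : ℕ) : Set X) (CWComplex.skeletonLT C (k : ℕ)) k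

lemma charMap_mapsTo {k : ℕ} (i : RelCWComplex.cell C k) :
    Set.MapsTo (charMap i) Set.univ (CWComplex.skeletonLT C (k + 1 : ℕ) : Set X) :=
  fun x _ => RelCWComplex.closedCell_subset_skeletonLT k i ⟨_, x.down.2, rfl⟩

lemma charMap_mapsTo_sphere {k : ℕ} (i : RelCWComplex.cell C k) :
    Set.MapsTo (charMap i) (diskSphere k) (CWComplex.skeletonLT C (k : ℕ) : Set X) :=
  fun _ hx => RelCWComplex.cellFrontier_subset_skeletonLT k i ⟨_, hx, rfl⟩

/-- The class in `H_k(X^(k), X^(k-1); ℤ)` of an oriented `k`-cell. -/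
noncomputable def cellClass (o : CellOrientation C) {k : ℕ} (i : RelCWComplex.cell C k) :
    CellHomology C k :=
  relMap (charMap i) (charMap_mapsTo i) (charMap_mapsTo_sphere i) k (o.gen k i)

variable [RelCWComplex.FiniteType C]

/-- The canonical map from the free abelian group on the `k`-cells to `H_k(X^(k), X^(k-1); ℤ)`.
It is an isomorphism, by excision. -/
noncomputable def cellIso (o : CellOrientation C) (k : ℕ) :
    (RelCWComplex.cell C k → ℤ) →ₗ[ℤ] CellHomology C k :=
  Fintype.linearCombination ℤ fun i => cellClass o i

open Classical in
/-- The cellular boundary operator `C_{k+1}(X; ℤ) → C_k(X; ℤ)` in the bases of oriented cells: the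
connecting map of the triple `(X^(k+1), X^(k), X^(k-1))`, transported along `cellIso`. As `cellIso`
is always bijective, the value `0` of the other branch is never taken. -/
noncomputable def cellBoundary (o : CellOrientation C) (k : ℕ) :
    (RelCWComplex.cell C (k + 1) → ℤ) →ₗ[ℤ] (RelCWComplex.cell C k → ℤ) :=
  if h : Function.Bijective (cellIso o k) then
    (LinearEquiv.ofBijective (cellIso o k) h).symm.toLinearMap ∘ₗ
      (relConnecting (CWComplex.skeletonLT C (k + 1 + 1 : ℕ) : Set X)
        (CWComplex.skeletonLT C (k + 1 : ℕ)) (CWComplex.skeletonLT C (k : ℕ)) k).toIntLinearMap ∘ₗ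
      cellIso o (k + 1)
  else 0

/-- The incidence numbers `[b : c]` of the `(k+1)`-cells `b` and the `k`-cells `c`. -/
noncomputable def incidence (o : CellOrientation C) (k : ℕ) :
    Matrix (RelCWComplex.cell C k) (RelCWComplex.cell C (k + 1)) ℤ :=
  LinearMap.toMatrix' (cellBoundary o k)

/-- The cellular boundary operator `C_{k+1}(X; R) → C_k(X; R)` with coefficients in `R`. -/
noncomputable def bdry (R : Type) [CommRing R] (o : CellOrientation C) (k : ℕ) :
    (RelCWComplex.cell C (k + 1) → R) →ₗ[R] (RelCWComplex.cell C k → R) :=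
  ((incidence o k).map (Int.cast : ℤ → R)).mulVecLin

/-! ### Subcomplexes, their cellular homology, and spanning trees -/

variable (C) in
/-- `X` as a subcomplex of itself. -/
def whole : CWComplex.Subcomplex C :=
  CWComplex.Subcomplex.mk'' C C (fun _ => Set.univ) (by
    simpa using CWComplex.iUnion_openCell_eq_complex (C := C))

/-- `C_k(T; R) ⊆ C_k(X; R)`: the chains supported on the cells of the subcomplex `T`. -/
def chains (R : Type) [CommRing R] (T : CWComplex.Subcomplex C) (k : ℕ) :
    Submodule R (RelCWComplex.cell C k → R) where
  carrier := {c | ∀ i, i ∉ T.I k → c i = 0}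
  add_mem' ha hb i hi := by simp [ha i hi, hb i hi]
  zero_mem' _ _ := rfl
  smul_mem' r c hc i hi := by simp [hc i hi]

/-- The cellular cycles `Z_k(T; R)`. -/
noncomputable def cycles (R : Type) [CommRing R] (o : CellOrientation C)
    (T : CWComplex.Subcomplex C) : ∀ k : ℕ, Submodule R (RelCWComplex.cell C k → R)
  | 0 => chains R T 0
  | k + 1 => chains R T (k + 1) ⊓ LinearMap.ker (bdry R o k)

/-- The cellular boundaries `B_k(T; R)`. -/
noncomputable def boundaries (R : Type) [CommRing R] (o : CellOrientation C)
    (T : CWComplex.Subcomplex C) (k : ℕ) : Submodule R (RelCWComplex.cell C k → R) :=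
  (chains R T (k + 1)).map (bdry R o k)

/-- The cellular homology `H_k(T; R)`. -/
abbrev Homology (R : Type) [CommRing R] (o : CellOrientation C)
    (T : CWComplex.Subcomplex C) (k : ℕ) : Type u :=
  cycles R o T k ⧸ (boundaries R o T k).submoduleOf (cycles R o T k)

/-- The Betti number `β_k(T)`. -/
noncomputable def betti (o : CellOrientation C) (T : CWComplex.Subcomplex C) (k : ℕ) : ℕ :=
  Module.finrank ℝ (Homology ℝ o T k)

variable (C) in
/-- The CW complex has dimension `d`. -/
def HasDim (d : ℕ) : Prop :=
  Nonempty (RelCWComplex.cell C d) ∧ ∀ k, d < k → IsEmpty (RelCWComplex.cell C k)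

/-- Spanning trees of a CW complex `X` of dimension `n + 1`. -/
structure IsSpanningTree (o : CellOrientation C) (n : ℕ) (T : CWComplex.Subcomplex C) : Prop where
  homology_eq_zero : Subsingleton (Homology ℤ o T (n + 1))
  betti_eq : betti o T n = betti o (whole C) n
  skeleton_subset : (CWComplex.skeleton C (n : ℕ∞) : Set X) ⊆ T

/-! ### The operators, for a complex of dimension `n + 1` -/

noncomputable instance subFintype (T : CWComplex.Subcomplex C) (k : ℕ) : Fintype (T.I k) :=
  Fintype.ofFinite _

noncomputable instance subDecidableEq (T : CWComplex.Subcomplex C) (k : ℕ) :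
    DecidableEq (T.I k) :=
  Classical.decEq _

/-- The boundary operator `∂_T : C_{n+1}(T; ℝ) → C_n(X; ℝ)`, where the cells are orthonormal
bases. (If `T` contains the `n`-skeleton then `C_n(T; ℝ) = C_n(X; ℝ)`.) -/
noncomputable def treeBdry (o : CellOrientation C) (n : ℕ) (T : CWComplex.Subcomplex C) :
    EuclideanSpace ℝ (T.I (n + 1)) →ₗ[ℝ] EuclideanSpace ℝ (RelCWComplex.cell C n) :=
  Matrix.toEuclideanLin
    (((incidence o n).map (Int.cast : ℤ → ℝ)).submatrix id (Subtype.val : T.I (n + 1) → _))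

/-- The operator `e^{-W}` on `C_{n+1}(T; ℝ)`, `b ↦ e^{-W_b} b`. -/
noncomputable def expNeg {n : ℕ} (T : CWComplex.Subcomplex C)
    (W : RelCWComplex.cell C (n + 1) → ℝ) :
    EuclideanSpace ℝ (T.I (n + 1)) →ₗ[ℝ] EuclideanSpace ℝ (T.I (n + 1)) :=
  Matrix.toEuclideanLin (Matrix.diagonal fun b : T.I (n + 1) => Real.exp (-W b))

/-- The operator `∂_T e^{-W} ∂_T^*` on `C_n(X; ℝ)`. -/
noncomputable def laplace (o : CellOrientation C) {n : ℕ} (T : CWComplex.Subcomplex C)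
    (W : RelCWComplex.cell C (n + 1) → ℝ) :
    EuclideanSpace ℝ (RelCWComplex.cell C n) →ₗ[ℝ] EuclideanSpace ℝ (RelCWComplex.cell C n) :=
  treeBdry o n T ∘ₗ expNeg T W ∘ₗ LinearMap.adjoint (treeBdry o n T)

/-- The operator `ℒ^T = ∂_T e^{-W} ∂_T^*` on `B_n(T; ℝ)`, the image of `∂_T`. -/
noncomputable def opL (o : CellOrientation C) {n : ℕ} (T : CWComplex.Subcomplex C)
    (W : RelCWComplex.cell C (n + 1) → ℝ) :
    LinearMap.range (treeBdry o n T) →ₗ[ℝ] LinearMap.range (treeBdry o n T) :=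
  (laplace o T W).restrict fun _ _ => LinearMap.mem_range_self _ _

/-- The inclusion `C_n(X; ℤ) → C_n(X; ℝ)`. -/
noncomputable def toReal {n : ℕ} (c : RelCWComplex.cell C n → ℤ) :
    EuclideanSpace ℝ (RelCWComplex.cell C n) :=
  WithLp.toLp 2 fun i => (c i : ℝ)

/-- The realification `A_ℝ ⊆ C_n(X; ℝ)` of a subgroup `A ⊆ C_n(X; ℤ)`, i.e. its real span. -/
noncomputable def realSpan {n : ℕ} (A : Submodule ℤ (RelCWComplex.cell C n → ℤ)) :
    Submodule ℝ (EuclideanSpace ℝ (RelCWComplex.cell C n)) :=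
  Submodule.span ℝ (toReal '' (A : Set (RelCWComplex.cell C n → ℤ)))

/-- The operator `ℒ_A^T = P_A ∂_T e^{-W} ∂_T^*` on `A_ℝ`, with `P_A` the orthogonal projection. -/
noncomputable def opLA (o : CellOrientation C) {n : ℕ}
    (A : Submodule ℤ (RelCWComplex.cell C n → ℤ)) (T : CWComplex.Subcomplex C)
    (W : RelCWComplex.cell C (n + 1) → ℝ) : realSpan A →ₗ[ℝ] realSpan A :=
  (realSpan A).orthogonalProjectionOnto.toLinearMap ∘ₗ laplace o T W ∘ₗ (realSpan A).subtype

/-- A real isomorphism: a homomorphism that becomes bijective after applying `ℝ ⊗ -`. -/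
def IsRealIso {M N : Type*} [AddCommGroup M] [AddCommGroup N] [Module ℤ M] [Module ℤ N]
    (p : M →ₗ[ℤ] N) : Prop :=
  Function.Bijective (p.baseChange ℝ)

/-- The orthogonal projection `B_n(X; ℝ) → A_ℝ` is induced by a real isomorphism
`B_n(X; ℤ) → A`. -/
def ProjectionIntegral (o : CellOrientation C) {n : ℕ}
    (A : Submodule ℤ (RelCWComplex.cell C n → ℤ)) : Prop :=
  ∃ p : boundaries ℤ o (whole C) n →ₗ[ℤ] A, IsRealIso p ∧
    ∀ b : boundaries ℤ o (whole C) n,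
      ((realSpan A).orthogonalProjectionOnto (toReal b.1) :
        EuclideanSpace ℝ (RelCWComplex.cell C n)) = toReal (p b).1

/-- `μ(A)`: the Gram determinant of a `ℤ`-basis of `A`, i.e. the squared covolume of `A` in `A_ℝ`
(it does not depend on the basis). -/
noncomputable def mu {n : ℕ} (A : Submodule ℤ (RelCWComplex.cell C n → ℤ)) : ℤ :=
  (Matrix.of fun i j => (Module.finBasis ℤ A i).1 ⬝ᵥ (Module.finBasis ℤ A j).1).det

end Cellular

end CellTree

/-! Write `D` for the real incidence matrix of the top cells and let `V` be a subspace of the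
`n`-chains, where `n = d - 1`, of dimension `r = rank D`. In an orthonormal basis of `V`, with
matrix `Q`, the compression of `∂ e^{-W} ∂*` to `V` is `(Q D) e^{-W} (Q D)ᵀ`. Cauchy–Binet writes
its determinant as a sum over `r`-element sets `S` of top cells; the term of `S` is the same
determinant with the weights outside `S` set to zero, i.e. the one belonging to the subcomplex with
top cells `S` and full `n`-skeleton.

A subcomplex containing the `n`-skeleton is a spanning tree exactly when the boundaries of its top
cells form a basis of `B_n(X; ℝ)` (`isSpanningTree_iff`): vanishing of the top homology is
independence, and equality of Betti numbers is equality of ranks. So every tree occurs as some `S`,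
while an `S` that is not a tree has a boundary map of rank less than `r` and contributes zero. This
is `det_compression_laplace`.

The two determinant identities are the cases `V = A_ℝ`, which has dimension `r` by the real
isomorphism, and `V = B_n(X; ℝ)`, which equals `B_n(T; ℝ)` for every tree. For `W = 0` and a tree
`T`, `∂_T ∂_T*` on the image of `∂_T` is conjugate to `∂_T* ∂_T`, the Gram matrix of a `ℤ`-basis of
`B_n(T; ℤ)`; see `det_opL_zero_eq_mu`. -/

namespace CellTree

/-! ### The Cauchy–Binet formula with weights -/

section CauchyBinet

variable {r m R : Type*} [Fintype r] [DecidableEq r] [Fintype m] [DecidableEq m] [CommRing R]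

/-- Each row of the product is a combination of the rows of `Mᵀ`; expand the determinant
multilinearly, `f` recording which row of `Mᵀ` is chosen in each place. -/
lemma det_mul_diagonal_mul_transpose (M : Matrix r m R) (w : m → R) :
    (M * Matrix.diagonal w * M.transpose).det =
      ∑ f : r → m, (∏ i, M i (f i) * w (f i)) * (M.transpose.submatrix f id).det := by
  have h : M * Matrix.diagonal w * M.transpose =
      fun i => ∑ k : m, (M i k * w k) • M.transpose k := by
    ext i j
    simp [Matrix.mul_apply, Matrix.diagonal_apply, Finset.sum_apply]
  rw [h]
  change Matrix.detRowAlternating.toMultilinearMap _ = _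
  rw [MultilinearMap.map_sum]
  refine Finset.sum_congr rfl fun f _ => ?_
  rw [MultilinearMap.map_smul_univ]
  rfl

/-- The Cauchy–Binet formula for `M diag(w) Mᵀ`, without a choice of orderings of the subsets. -/
lemma det_mul_diagonal_mul_transpose_eq_sum_powersetCard (M : Matrix r m R) (w : m → R) :
    (M * Matrix.diagonal w * M.transpose).det =
      ∑ S ∈ Finset.powersetCard (Fintype.card r) (Finset.univ : Finset m),
        (M * Matrix.diagonal (fun k => if k ∈ S then w k else 0) * M.transpose).det := by
  simp_rw [det_mul_diagonal_mul_transpose]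
  rw [Finset.sum_comm]
  refine Finset.sum_congr rfl fun f _ => ?_
  by_cases hf : Function.Injective f
  -- An injective `f` survives only in the sets `S` containing its image, and by cardinality the
  -- image is the only such set.
  · rw [Finset.sum_eq_single (Finset.univ.image f)]
    · simp
    · intro S hS hne
      obtain ⟨i, hi⟩ : ∃ i, f i ∉ S := by
        by_contra! h
        refine hne (Finset.eq_of_subset_of_card_le ?_ ?_).symm
        · intro x hx
          obtain ⟨i, -, rfl⟩ := Finset.mem_image.1 hx
          exact h i
        · rw [Finset.card_image_of_injective _ hf, (Finset.mem_powersetCard.1 hS).2,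
            Finset.card_univ]
      rw [Finset.prod_eq_zero (Finset.mem_univ i) (by simp [hi]), zero_mul]
    · intro h
      refine absurd (Finset.mem_powersetCard.2 ⟨Finset.subset_univ _, ?_⟩) h
      rw [Finset.card_image_of_injective _ hf, Finset.card_univ]
  · have h0 : (M.transpose.submatrix f id).det = 0 := by
      simp only [Function.Injective, not_forall] at hf
      obtain ⟨i, j, hij, hne⟩ := hf
      exact Matrix.det_zero_of_row_eq hne (by ext k; simp [hij])
    simp [h0]

end CauchyBinet

/-! ### Compressions of operators to a subspace -/

section Compression

variable {k m : Type*} [Fintype k]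

/-- The compression `P_V L|_V` of an operator to a subspace. -/
noncomputable def compression (V : Submodule ℝ (EuclideanSpace ℝ k))
    (L : EuclideanSpace ℝ k →ₗ[ℝ] EuclideanSpace ℝ k) : V →ₗ[ℝ] V :=
  V.orthogonalProjectionOnto.toLinearMap ∘ₗ L ∘ₗ V.subtype

/-- The rows of the outer factor are an orthonormal basis of `V`, and the entries of the compression
in that basis are the inner products `⟪v_i, N v_j⟫`, since projecting to `V` does not change inner
products with vectors of `V`. -/
lemma det_compression_toEuclideanLin [DecidableEq k] (V : Submodule ℝ (EuclideanSpace ℝ k)) (N : Matrix k k ℝ) :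
    LinearMap.det (compression V (Matrix.toEuclideanLin N)) =
      ((Matrix.of fun i a => (stdOrthonormalBasis ℝ V i : EuclideanSpace ℝ k) a) * N *
        (Matrix.of fun i a => (stdOrthonormalBasis ℝ V i : EuclideanSpace ℝ k) a).transpose).det := by
  rw [← LinearMap.det_toMatrix (stdOrthonormalBasis ℝ V).toBasis]
  congr 1
  ext i j
  rw [LinearMap.toMatrix_apply, OrthonormalBasis.coe_toBasis, OrthonormalBasis.coe_toBasis_repr_apply,
    OrthonormalBasis.repr_apply_apply]
  have h : inner ℝ (stdOrthonormalBasis ℝ V i)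
      (compression V (Matrix.toEuclideanLin N) (stdOrthonormalBasis ℝ V j)) =
      inner ℝ (stdOrthonormalBasis ℝ V i : EuclideanSpace ℝ k)
        (Matrix.toEuclideanLin N (stdOrthonormalBasis ℝ V j)) := by
    simp [compression]
  rw [h, Matrix.mul_assoc, Matrix.mul_apply]
  simp [PiLp.inner_apply, Matrix.mul_apply, Matrix.mulVec, dotProduct, mul_comm]

lemma det_compression_eq_sum [DecidableEq k] [Fintype m] [DecidableEq m]
    (V : Submodule ℝ (EuclideanSpace ℝ k)) (D : Matrix k m ℝ) (w : m → ℝ) :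
    LinearMap.det (compression V (Matrix.toEuclideanLin (D * Matrix.diagonal w * D.transpose))) =
      ∑ S ∈ Finset.powersetCard (Module.finrank ℝ V) (Finset.univ : Finset m),
        LinearMap.det (compression V (Matrix.toEuclideanLin
          (D * Matrix.diagonal (fun b => if b ∈ S then w b else 0) * D.transpose))) := by
  simp_rw [det_compression_toEuclideanLin]
  set Q : Matrix (Fin (Module.finrank ℝ V)) k ℝ :=
    Matrix.of fun i a => (stdOrthonormalBasis ℝ V i : EuclideanSpace ℝ k) a
  have h (v : m → ℝ) : Q * (D * Matrix.diagonal v * D.transpose) * Q.transpose =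
      (Q * D) * Matrix.diagonal v * (Q * D).transpose := by
    simp only [Matrix.transpose_mul, Matrix.mul_assoc]
  simp_rw [h]
  rw [det_mul_diagonal_mul_transpose_eq_sum_powersetCard, Fintype.card_fin]

/-- An invertible compression would make `L` injective on `V`, embedding `V` in the range of `L`. -/
lemma det_compression_eq_zero (V : Submodule ℝ (EuclideanSpace ℝ k))
    (L : EuclideanSpace ℝ k →ₗ[ℝ] EuclideanSpace ℝ k)
    (h : Module.finrank ℝ (LinearMap.range L) < Module.finrank ℝ V) :
    LinearMap.det (compression V L) = 0 := by
  by_contra h0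
  have hinj : Function.Injective (compression V L) :=
    (LinearMap.equivOfDetNeZero _ h0).injective
  have h1 : Function.Injective (L.rangeRestrict ∘ₗ V.subtype) := by
    intro x y hxy
    refine hinj ?_
    have : L x = L y := congrArg Subtype.val hxy
    simp [compression, this]
  exact absurd (LinearMap.finrank_le_finrank_of_injective h1) (not_le.2 h)

end Compression

/-! ### Integral vectors and Gram determinants -/

section IntegralStructure

variable {k : Type*} [Fintype k]

lemma linearIndependent_toLp_intCast {ι : Type*} {v : ι → k → ℤ} :
    LinearIndependent ℝ (fun i => (WithLp.toLp 2 fun a => (v i a : ℝ) : EuclideanSpace ℝ k)) ↔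
      LinearIndependent ℤ v := by
  rw [← linearIndependent_algebraMap_comp_iff (S := ℝ)]
  exact LinearMap.linearIndependent_iff_of_injOn (v := fun i => algebraMap ℤ ℝ ∘ v i)
    (WithLp.linearEquiv 2 ℝ (k → ℝ)).symm.toLinearMap
    (WithLp.linearEquiv 2 ℝ (k → ℝ)).symm.injective.injOn

/-- A change of `ℤ`-basis has determinant `±1` and multiplies the Gram determinant by its square.
This allows `mu` to be computed in the basis given by the boundaries of cells. -/
lemma det_gram_eq_of_basis {ι κ : Type*} [Fintype ι] [DecidableEq ι] [Fintype κ] [DecidableEq κ]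
    {A : Submodule ℤ (k → ℤ)} (b : Module.Basis ι ℤ A) (c : Module.Basis κ ℤ A) :
    (Matrix.of fun i j => (b i).1 ⬝ᵥ (b j).1).det =
      (Matrix.of fun i j => (c i).1 ⬝ᵥ (c j).1).det := by
  classical
  let e := b.indexEquiv c
  let c' := c.reindex e.symm
  have h1 : (Matrix.of fun i j => (c i).1 ⬝ᵥ (c j).1).det =
      (Matrix.of fun i j => (c' i).1 ⬝ᵥ (c' j).1).det := by
    rw [← Matrix.det_submatrix_equiv_self e]
    congr 1
    ext i j
    simp [c']
  let P := c'.toMatrix b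
  have hb (i : ι) : (b i).1 = ∑ l, P l i • (c' l).1 := by
    have h := congrArg Subtype.val (c'.sum_toMatrix_smul_self b i)
    rw [← h, AddSubmonoidClass.coe_finsetSum]
    rfl
  have h2 : (Matrix.of fun i j => (b i).1 ⬝ᵥ (b j).1) =
      P.transpose * (Matrix.of fun i j => (c' i).1 ⬝ᵥ (c' j).1) * P := by
    ext i j
    rw [Matrix.of_apply, hb i, hb j, Matrix.mul_assoc]
    simp only [sum_dotProduct, dotProduct_sum, smul_dotProduct, dotProduct_smul, Matrix.mul_apply,
      Matrix.transpose_apply, Matrix.of_apply, smul_eq_mul, Finset.mul_sum]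
    rw [Finset.sum_comm]
    refine Finset.sum_congr rfl fun _ _ => Finset.sum_congr rfl fun _ _ => by ring
  have h3 : IsUnit P.det :=
    Matrix.isUnit_det_of_right_inverse (c'.toMatrix_mul_toMatrix_flip b)
  have h4 : P.det * P.det = 1 := by
    rcases Int.isUnit_iff.1 h3 with h | h <;> simp [h]
  rw [h1, h2, Matrix.det_mul, Matrix.det_mul, Matrix.det_transpose]
  linear_combination (Matrix.of fun i j => (c' i).1 ⬝ᵥ (c' j).1).det * h4

end IntegralStructure

/-! ### Subcomplexes containing the `n`-skeleton correspond to sets of top cells -/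

section Cells

variable {X : Type u} [TopologicalSpace X] {C : Set X} [CWComplex C] [T2Space X]

lemma whole_I [RelCWComplex.FiniteType C] (k : ℕ) : (whole C).I k = Set.univ := rfl

/-- An open cell not belonging to `T` is disjoint from `T`, but open cells of dimension at most `n`
lie in the skeleton. -/
lemma I_eq_univ_of_skeleton_subset {T : CWComplex.Subcomplex C} {n k : ℕ} (hk : k ≤ n)
    (hT : (CWComplex.skeleton C (n : ℕ∞) : Set X) ⊆ T) : T.I k = Set.univ := by
  refine Set.eq_univ_of_forall fun i => ?_
  by_contra hi
  obtain ⟨x, hx⟩ := RelCWComplex.openCell_nonempty (C := C) k i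
  refine (RelCWComplex.Subcomplex.disjoint_openCell_subcomplex_of_not_mem T hi).notMem_of_mem_left
    hx (hT ?_)
  exact CWComplex.mem_skeleton_iff.2 ⟨k, by exact_mod_cast hk, i, hx⟩

omit [T2Space X] in
lemma subcomplex_ext_of_I_eq {T T' : CWComplex.Subcomplex C} (h : ∀ k, T.I k = T'.I k) :
    T = T' := by
  have hI : T.I = T'.I := funext h
  rw [CWComplex.Subcomplex.eq_iff, ← CWComplex.Subcomplex.union (E := T),
    ← CWComplex.Subcomplex.union (E := T'), hI]

lemma subcomplex_ext_of_skeleton_subset {n : ℕ} (hdim : HasDim C (n + 1))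
    {T T' : CWComplex.Subcomplex C} (hT : (CWComplex.skeleton C (n : ℕ∞) : Set X) ⊆ T)
    (hT' : (CWComplex.skeleton C (n : ℕ∞) : Set X) ⊆ T') (h : T.I (n + 1) = T'.I (n + 1)) :
    T = T' := by
  refine subcomplex_ext_of_I_eq fun k => ?_
  rcases lt_trichotomy k (n + 1) with hk | rfl | hk
  · rw [I_eq_univ_of_skeleton_subset (Nat.lt_succ_iff.1 hk) hT,
      I_eq_univ_of_skeleton_subset (Nat.lt_succ_iff.1 hk) hT']
  · exact h
  · have := hdim.2 k hk
    exact Subsingleton.elim _ _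

/-- The subcomplex consisting of the `n`-skeleton and a set of `(n+1)`-cells. -/
def skeletonUnion (n : ℕ) (S : Set (RelCWComplex.cell C (n + 1))) : CWComplex.Subcomplex C :=
  CWComplex.Subcomplex.mk' C
    (⋃ (k : ℕ) (j : {i : RelCWComplex.cell C k | k ≤ n + 1 ∧ ∀ h : k = n + 1, h ▸ i ∈ S}),
      RelCWComplex.openCell k j.1)
    (fun k => {i | k ≤ n + 1 ∧ ∀ h : k = n + 1, h ▸ i ∈ S})
    (by
      rintro k ⟨i, hk, hi⟩ x hx
      -- The frontier is covered by open cells of dimension `m < k ≤ n + 1`, for which the condition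
      -- on `S` is vacuous.
      rw [← RelCWComplex.cellFrontier_union_openCell_eq_closedCell] at hx
      rcases hx with hx | hx
      · obtain ⟨m, hm, j, hj⟩ := CWComplex.mem_skeletonLT_iff.1
          (RelCWComplex.cellFrontier_subset_skeletonLT k i hx)
        have hm' : m < k := by exact_mod_cast hm
        exact Set.mem_iUnion₂.2 ⟨m, ⟨j, by omega, fun h => by omega⟩, hj⟩
      · exact Set.mem_iUnion₂.2 ⟨k, ⟨i, hk, hi⟩, hx⟩)
    rfl

lemma skeletonUnion_I (n : ℕ) (S : Set (RelCWComplex.cell C (n + 1))) :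
    (skeletonUnion n S).I (n + 1) = S := by
  ext i
  change (n + 1 ≤ n + 1 ∧ ∀ h : n + 1 = n + 1, h ▸ i ∈ S) ↔ _
  simp

lemma skeleton_subset_skeletonUnion (n : ℕ) (S : Set (RelCWComplex.cell C (n + 1))) :
    (CWComplex.skeleton C (n : ℕ∞) : Set X) ⊆ skeletonUnion n S := by
  intro x hx
  obtain ⟨m, hm, j, hj⟩ := CWComplex.mem_skeleton_iff.1 hx
  have hm' : m ≤ n := by exact_mod_cast hm
  exact Set.mem_iUnion₂.2 ⟨m, ⟨j, by omega, fun h => by omega⟩, hj⟩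

end Cells

/-! ### Chains supported on a subcomplex -/

section Chains

variable {X : Type u} [TopologicalSpace X] {C : Set X} [CWComplex C]

lemma sum_subtype_eq_of_mem_chains [RelCWComplex.FiniteType C] {R : Type} [CommRing R] {T : CWComplex.Subcomplex C} {k : ℕ}
    {M : Type*} [AddCommGroup M] [Module R M] (f : RelCWComplex.cell C k → M)
    {x : RelCWComplex.cell C k → R} (hx : x ∈ chains R T k) :
    ∑ b, x b • f b = ∑ b : T.I k, x b • f b := by
  classical
  rw [← Finset.sum_subset (Finset.subset_univ (Finset.univ.filter (· ∈ T.I k)))]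
  · rw [← Finset.sum_subtype_eq_sum_filter, Finset.subtype_univ]
  · intro b _ hb
    rw [hx b (by simpa using hb), zero_smul]

open Classical in
/-- Extension by zero. -/
noncomputable def extendChain {R : Type} [CommRing R] {T : CWComplex.Subcomplex C} {k : ℕ}
    (g : T.I k → R) (b : RelCWComplex.cell C k) : R :=
  if h : b ∈ T.I k then g ⟨b, h⟩ else 0

lemma extendChain_mem {R : Type} [CommRing R] {T : CWComplex.Subcomplex C} {k : ℕ}
    (g : T.I k → R) : extendChain g ∈ chains R T k :=
  fun _ hb => dif_neg hb

@[simp] lemma extendChain_coe {R : Type} [CommRing R] {T : CWComplex.Subcomplex C} {k : ℕ}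
    (g : T.I k → R) (b : T.I k) : extendChain g b = g b :=
  dif_pos b.2

end Chains

/-! ### Cellular boundaries, cycles and Betti numbers -/

section Boundary

lemma relConnecting_relConnecting {Y : Type u} [TopologicalSpace Y] (U V W W' : Set Y) (k : ℕ)
    (x : RelHomology U V (k + 1 + 1)) :
    relConnecting V W W' k (relConnecting U V W (k + 1) x) = 0 := by
  induction x using QuotientAddGroup.induction_on with
  | H c =>
    refine (QuotientAddGroup.eq_zero_iff _).2 ?_
    rw [AddSubgroup.mem_addSubgroupOf]
    change singD Y (k + 1) k (singD Y (k + 1 + 1) (k + 1) c.1) ∈ _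
    rw [singD_singD]
    exact zero_mem _

variable {X : Type u} [TopologicalSpace X] {C : Set X} [CWComplex C] [T2Space X]
  [RelCWComplex.FiniteType C] (o : CellOrientation C)

lemma cellBoundary_comp_cellBoundary (k : ℕ) :
    cellBoundary o k ∘ₗ cellBoundary o (k + 1) = 0 := by
  unfold cellBoundary
  split_ifs with h h'
  · refine LinearMap.ext fun y => ?_
    simp only [LinearMap.comp_apply, LinearEquiv.coe_coe]
    have hz : ∀ z, cellIso o (k + 1) ((LinearEquiv.ofBijective (cellIso o (k + 1)) h').symm z) = z :=
      fun z => (LinearEquiv.ofBijective (cellIso o (k + 1)) h').apply_symm_apply z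
    rw [hz]
    erw [relConnecting_relConnecting]
    simp
  -- In the remaining cases one of the two factors is the default value `0`, so bijectivity of
  -- `cellIso` need not be known.
  all_goals simp

lemma incidence_mul_incidence (k : ℕ) : incidence o k * incidence o (k + 1) = 0 := by
  rw [incidence, incidence, ← LinearMap.toMatrix'_comp, cellBoundary_comp_cellBoundary, map_zero]

lemma bdry_comp_bdry (R : Type) [CommRing R] (k : ℕ) : bdry R o k ∘ₗ bdry R o (k + 1) = 0 := by
  have h := congrArg (fun M => M.map (Int.castRingHom R)) (incidence_mul_incidence o k)
  simp only [Matrix.map_mul] at h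
  rw [bdry, bdry, ← Matrix.mulVecLin_mul]
  erw [h]
  simp

/-- The boundary of a cell, with coefficients in `R`. -/
noncomputable def cellBdry (R : Type) [CommRing R] (k : ℕ) (b : RelCWComplex.cell C (k + 1)) :
    RelCWComplex.cell C k → R :=
  fun c => (incidence o k c b : R)

lemma bdry_apply (R : Type) [CommRing R] (k : ℕ) (x : RelCWComplex.cell C (k + 1) → R) :
    bdry R o k x = ∑ b, x b • cellBdry o R k b := by
  ext c
  simp [bdry, cellBdry, Matrix.mulVec, dotProduct, mul_comm]

lemma boundaries_eq_span (R : Type) [CommRing R] (T : CWComplex.Subcomplex C) (k : ℕ) :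
    boundaries R o T k =
      Submodule.span R (Set.range fun b : T.I (k + 1) => cellBdry o R k b) := by
  ext y
  rw [Submodule.mem_span_range_iff_exists_fun]
  constructor
  · rintro ⟨x, hx, rfl⟩
    exact ⟨fun b => x b, by rw [bdry_apply, sum_subtype_eq_of_mem_chains _ hx]⟩
  · rintro ⟨g, rfl⟩
    refine ⟨extendChain g, extendChain_mem g, ?_⟩
    rw [bdry_apply, sum_subtype_eq_of_mem_chains _ (extendChain_mem g)]
    simp

lemma boundaries_le_cycles (R : Type) [CommRing R] {T : CWComplex.Subcomplex C} {k : ℕ}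
    (hT : T.I k = Set.univ) : boundaries R o T k ≤ cycles R o T k := by
  have hc (x) : x ∈ chains R T k := fun i hi => absurd (hT ▸ Set.mem_univ i) hi
  rintro _ ⟨x, -, rfl⟩
  cases k with
  | zero => exact hc _
  | succ k => exact ⟨hc _, LinearMap.congr_fun (bdry_comp_bdry o R k) x⟩

lemma cycles_eq_of_I_eq (R : Type) [CommRing R] {T T' : CWComplex.Subcomplex C} {k : ℕ}
    (h : T.I k = T'.I k) : cycles R o T k = cycles R o T' k := by
  have hc : chains R T k = chains R T' k := by
    ext x
    exact ⟨fun hx i hi => hx i (h ▸ hi), fun hx i hi => hx i (h ▸ hi)⟩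
  cases k with
  | zero => exact hc
  | succ k => simp only [cycles, hc]

lemma betti_add_finrank_boundaries {T : CWComplex.Subcomplex C} {k : ℕ}
    (hT : T.I k = Set.univ) :
    betti o T k + Module.finrank ℝ (boundaries ℝ o T k) = Module.finrank ℝ (cycles ℝ o T k) := by
  rw [betti, ← Submodule.finrank_quotient_add_finrank
    ((boundaries ℝ o T k).submoduleOf (cycles ℝ o T k)),
    (Submodule.submoduleOfEquivOfLe (boundaries_le_cycles o ℝ hT)).finrank_eq]

/-- The cycles depend only on the `k`-cells, which `T` shares with `X`, so the Betti numbers differ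
only through the ranks of the boundaries. -/
lemma betti_eq_iff {T : CWComplex.Subcomplex C} {k : ℕ} (hT : T.I k = Set.univ) :
    betti o T k = betti o (whole C) k ↔
      Module.finrank ℝ (boundaries ℝ o T k) = Module.finrank ℝ (boundaries ℝ o (whole C) k) := by
  have h1 := betti_add_finrank_boundaries o hT
  have h2 := betti_add_finrank_boundaries o (whole_I (C := C) k)
  rw [cycles_eq_of_I_eq o ℝ (hT.trans (whole_I (C := C) k).symm)] at h1
  omega

/-- Without `(n+2)`-cells the top homology is the group of cycles, i.e. of integral relations
between the boundaries of the top cells of `T`. -/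
lemma subsingleton_homology_iff {n : ℕ} (hdim : HasDim C (n + 1)) (T : CWComplex.Subcomplex C) :
    Subsingleton (Homology ℤ o T (n + 1)) ↔
      LinearIndependent ℤ fun b : T.I (n + 1) => cellBdry o ℤ n b := by
  have hempty := hdim.2 (n + 1 + 1) (by omega)
  have hB : boundaries ℤ o T (n + 1) = ⊥ := by
    rw [boundaries_eq_span, Submodule.span_eq_bot]
    rintro _ ⟨b, rfl⟩
    exact isEmptyElim b.1
  rw [Submodule.Quotient.subsingleton_iff, Submodule.submoduleOf_eq_top, hB,
    le_bot_iff, Fintype.linearIndependent_iff, Submodule.eq_bot_iff]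
  constructor
  · intro h g hg b
    have := h (extendChain g) ⟨extendChain_mem g, by
      rw [SetLike.mem_coe, LinearMap.mem_ker, bdry_apply,
        sum_subtype_eq_of_mem_chains _ (extendChain_mem g)]
      simpa using hg⟩
    rw [← extendChain_coe g b, this]
    rfl
  · rintro h x ⟨hx, hx'⟩
    rw [SetLike.mem_coe, LinearMap.mem_ker, bdry_apply,
      sum_subtype_eq_of_mem_chains _ hx] at hx'
    ext b
    by_cases hb : b ∈ T.I (n + 1)
    · exact h _ hx' ⟨b, hb⟩
    · exact hx b hb

end Boundary

/-! ### Real spans of integral lattices -/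

section RealSpan

variable {X : Type u} [TopologicalSpace X] {C : Set X} [CWComplex C] {n : ℕ}

lemma realSpan_span (s : Set (RelCWComplex.cell C n → ℤ)) :
    realSpan (Submodule.span ℤ s) = Submodule.span ℝ (toReal '' s) := by
  refine le_antisymm (Submodule.span_le.2 ?_)
    (Submodule.span_mono (Set.image_mono Submodule.subset_span))
  rintro _ ⟨x, hx, rfl⟩
  rw [SetLike.mem_coe]
  induction hx using Submodule.span_induction with
  | mem x hx => exact Submodule.subset_span ⟨x, hx, rfl⟩
  | zero =>
    convert Submodule.zero_mem _ using 1
    ext i; simp [toReal]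
  | add x y _ _ hx hy =>
    convert Submodule.add_mem _ hx hy using 1
    ext i; simp [toReal]
  | smul a x _ hx =>
    convert Submodule.smul_mem _ (a : ℝ) hx using 1
    ext i; simp [toReal]

variable [RelCWComplex.FiniteType C]

lemma linearIndependent_toReal {ι : Type*} {v : ι → RelCWComplex.cell C n → ℤ} :
    LinearIndependent ℝ (fun i => toReal (v i)) ↔ LinearIndependent ℤ v :=
  linearIndependent_toLp_intCast

/-- A `ℤ`-basis of `A` stays independent over `ℝ`, hence is a basis of the real span. -/
lemma finrank_realSpan (A : Submodule ℤ (RelCWComplex.cell C n → ℤ)) :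
    Module.finrank ℝ (realSpan A) = Module.finrank ℤ A := by
  let b := Module.finBasis ℤ A
  have hA : A = Submodule.span ℤ (Set.range fun i => (b i : RelCWComplex.cell C n → ℤ)) := by
    have h := congrArg (Submodule.map A.subtype) b.span_eq
    rw [Submodule.map_top, Submodule.range_subtype, Submodule.map_span, ← Set.range_comp] at h
    exact h.symm
  have hli : LinearIndependent ℤ fun i => (b i : RelCWComplex.cell C n → ℤ) :=
    b.linearIndependent.map' A.subtype A.ker_subtype
  have h := finrank_span_eq_card (linearIndependent_toReal.2 hli)
  rw [Fintype.card_fin] at h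
  rw [← h]
  conv_lhs => rw [hA, realSpan_span, ← Set.range_comp]
  rfl

end RealSpan

/-! ### Spanning trees and the determinants of their operators -/

section Operators

variable {X : Type u} [TopologicalSpace X] {C : Set X} [CWComplex C] [T2Space X]
  [RelCWComplex.FiniteType C] (o : CellOrientation C) {n : ℕ}

/-- The matrix of `∂_T`. -/
noncomputable abbrev treeMatrix (o : CellOrientation C) (n : ℕ) (T : CWComplex.Subcomplex C) :
    Matrix (RelCWComplex.cell C n) (T.I (n + 1)) ℝ :=
  ((incidence o n).map (Int.cast : ℤ → ℝ)).submatrix id Subtype.val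

lemma cellBdry_int (b : RelCWComplex.cell C (n + 1)) (c : RelCWComplex.cell C n) :
    cellBdry o ℤ n b c = incidence o n c b := by
  simp [cellBdry]

lemma treeBdry_apply (T : CWComplex.Subcomplex C) (x : EuclideanSpace ℝ (T.I (n + 1))) :
    treeBdry o n T x = ∑ b, x b • toReal (cellBdry o ℤ n b) := by
  ext c
  simp [treeBdry, toReal, cellBdry_int, Matrix.mulVec, dotProduct, mul_comm]

lemma range_treeBdry (T : CWComplex.Subcomplex C) :
    LinearMap.range (treeBdry o n T) =
      Submodule.span ℝ (Set.range fun b : T.I (n + 1) => toReal (cellBdry o ℤ n b)) := by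
  ext y
  rw [Submodule.mem_span_range_iff_exists_fun]
  constructor
  · rintro ⟨x, rfl⟩
    exact ⟨x, (treeBdry_apply o T x).symm⟩
  · rintro ⟨g, rfl⟩
    exact ⟨WithLp.toLp 2 g, treeBdry_apply o T _⟩

lemma realSpan_boundaries (T : CWComplex.Subcomplex C) :
    realSpan (boundaries ℤ o T n) = LinearMap.range (treeBdry o n T) := by
  rw [boundaries_eq_span, realSpan_span, range_treeBdry, ← Set.range_comp]
  rfl

lemma finrank_boundaries (T : CWComplex.Subcomplex C) :
    Module.finrank ℝ (boundaries ℝ o T n) =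
      Module.finrank ℝ (LinearMap.range (treeBdry o n T)) := by
  rw [range_treeBdry, boundaries_eq_span,
    ← LinearEquiv.finrank_map_eq (WithLp.linearEquiv 2 ℝ (RelCWComplex.cell C n → ℝ)).symm,
    Submodule.map_span, ← Set.range_comp]
  congr! 4

lemma range_treeBdry_le_whole (T : CWComplex.Subcomplex C) :
    LinearMap.range (treeBdry o n T) ≤ LinearMap.range (treeBdry o n (whole C)) := by
  rw [range_treeBdry, range_treeBdry]
  refine Submodule.span_mono ?_
  rintro _ ⟨b, rfl⟩
  exact ⟨⟨b, Set.mem_univ _⟩, rfl⟩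

/-- The homological definition becomes linear algebra: since the cell boundaries are integral
vectors, independence over `ℤ` is independence over `ℝ`, and the Betti condition is one on ranks. -/
lemma isSpanningTree_iff (hdim : HasDim C (n + 1)) {T : CWComplex.Subcomplex C}
    (hT : (CWComplex.skeleton C (n : ℕ∞) : Set X) ⊆ T) :
    IsSpanningTree o n T ↔
      LinearIndependent ℝ (fun b : T.I (n + 1) => toReal (cellBdry o ℤ n b)) ∧
        Module.finrank ℝ (LinearMap.range (treeBdry o n T)) =
          Module.finrank ℝ (LinearMap.range (treeBdry o n (whole C))) := by
  have hI := I_eq_univ_of_skeleton_subset le_rfl hT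
  rw [linearIndependent_toReal (v := fun b : T.I (n + 1) => cellBdry o ℤ n b),
    ← finrank_boundaries, ← finrank_boundaries, ← betti_eq_iff o hI,
    ← subsingleton_homology_iff o hdim]
  exact ⟨fun h => ⟨h.1, h.2⟩, fun h => ⟨h.1, h.2, hT⟩⟩

-- Passing to a subcomplex is expressed by annihilating weights rather than deleting columns, which
-- is the form of the terms in `det_compression_eq_sum`.
open Classical in
lemma laplace_eq_toEuclideanLin (T : CWComplex.Subcomplex C)
    (W : RelCWComplex.cell C (n + 1) → ℝ) :
    laplace o T W = Matrix.toEuclideanLin ((incidence o n).map (Int.cast : ℤ → ℝ) *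
      Matrix.diagonal (fun b => if b ∈ T.I (n + 1) then Real.exp (-W b) else 0) *
      ((incidence o n).map (Int.cast : ℤ → ℝ)).transpose) := by
  have h : laplace o T W = Matrix.toEuclideanLin (treeMatrix o n T *
      ((Matrix.diagonal fun b : T.I (n + 1) => Real.exp (-W b)) *
        (treeMatrix o n T).conjTranspose)) := by
    rw [laplace, treeBdry, expNeg, ← Matrix.toEuclideanLin_conjTranspose_eq_adjoint,
      Matrix.toLpLin_mul 2 2 2, Matrix.toLpLin_mul 2 2 2]
  rw [h]
  congr 1
  ext i j
  rw [Matrix.mul_apply, Matrix.mul_apply]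
  simp only [Matrix.mul_diagonal, Matrix.diagonal_mul, Matrix.transpose_apply,
    Matrix.conjTranspose_apply, Matrix.submatrix_apply, Matrix.map_apply, id, mul_ite, ite_mul,
    mul_zero, zero_mul, star_trivial]
  rw [← Finset.sum_filter, ← Finset.sum_subtype_eq_sum_filter, Finset.subtype_univ]
  exact Finset.sum_congr rfl fun _ _ => by ring

lemma range_laplace_le (T : CWComplex.Subcomplex C) (W : RelCWComplex.cell C (n + 1) → ℝ) :
    LinearMap.range (laplace o T W) ≤ LinearMap.range (treeBdry o n T) :=
  LinearMap.range_comp_le_range _ _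

lemma opL_eq_compression (T : CWComplex.Subcomplex C) (W : RelCWComplex.cell C (n + 1) → ℝ) :
    opL o T W = compression (LinearMap.range (treeBdry o n T)) (laplace o T W) := by
  ext1 x
  exact (Submodule.orthogonalProjectionOnto_mem_subspace_eq_self (opL o T W x)).symm

/-- Independence makes `∂_T` an isomorphism onto its image, which conjugates `∂_T* ∂_T` to `∂_T
∂_T*`. The matrix of `∂_T* ∂_T` is the Gram matrix of the cell boundaries, and these form a
`ℤ`-basis of `B_n(T; ℤ)`. -/
lemma det_opL_zero_eq_mu {T : CWComplex.Subcomplex C}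
    (h : LinearIndependent ℝ fun b : T.I (n + 1) => toReal (cellBdry o ℤ n b)) :
    LinearMap.det (opL o T (0 : RelCWComplex.cell C (n + 1) → ℝ)) =
      (mu (boundaries ℤ o T n) : ℝ) := by
  have hinj : Function.Injective (treeBdry o n T) := by
    rw [injective_iff_map_eq_zero]
    intro x hx
    rw [treeBdry_apply] at hx
    ext b
    exact Fintype.linearIndependent_iff.1 h _ hx b
  let e := LinearEquiv.ofInjective (treeBdry o n T) hinj
  have hexp : expNeg T (0 : RelCWComplex.cell C (n + 1) → ℝ) = LinearMap.id := by
    ext; simp [expNeg]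
  have hconj : opL o T (0 : RelCWComplex.cell C (n + 1) → ℝ) =
      e.toLinearMap ∘ₗ (LinearMap.adjoint (treeBdry o n T) ∘ₗ treeBdry o n T) ∘ₗ
        e.symm.toLinearMap := by
    refine LinearMap.ext fun y => ?_
    obtain ⟨x, rfl⟩ := e.surjective y
    refine Subtype.ext ?_
    change laplace o T 0 (treeBdry o n T x) = _
    simp [laplace, hexp, e]
  rw [hconj, LinearMap.det_conj, treeBdry, ← Matrix.toEuclideanLin_conjTranspose_eq_adjoint,
    ← Matrix.toLpLin_mul 2 2 2, LinearMap.det_toLpLin]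
  have hli := linearIndependent_toReal (v := fun b : T.I (n + 1) => cellBdry o ℤ n b).1 h
  let c : Module.Basis (T.I (n + 1)) ℤ (boundaries ℤ o T n) :=
    (Module.Basis.span hli).map (LinearEquiv.ofEq _ _ (boundaries_eq_span o ℤ T n).symm)
  have hc (b : T.I (n + 1)) : (c b).1 = cellBdry o ℤ n b := by
    simp only [c, Module.Basis.map_apply, LinearEquiv.coe_ofEq_apply, Module.Basis.span_apply]
  rw [mu, det_gram_eq_of_basis _ c, Int.cast_det]
  congr 1
  ext i j
  simp [hc, Matrix.mul_apply, dotProduct, cellBdry_int]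

/-- The common source of both determinant identities: only the dimension of `V` enters, as the size
of the sets in Cauchy–Binet. -/
lemma det_compression_laplace (hdim : HasDim C (n + 1))
    (hfin : {T : CWComplex.Subcomplex C | IsSpanningTree o n T}.Finite)
    (W : RelCWComplex.cell C (n + 1) → ℝ)
    (V : Submodule ℝ (EuclideanSpace ℝ (RelCWComplex.cell C n)))
    (hV : Module.finrank ℝ V = Module.finrank ℝ (LinearMap.range (treeBdry o n (whole C)))) :
    LinearMap.det (compression V (laplace o (whole C) W)) =
      ∑ᶠ T : {T : CWComplex.Subcomplex C // IsSpanningTree o n T},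
        LinearMap.det (compression V (laplace o T.1 W)) := by
  classical
  have := hfin.fintype
  change Fintype {T : CWComplex.Subcomplex C // IsSpanningTree o n T} at this
  have hcell (T : CWComplex.Subcomplex C) {S : Finset (RelCWComplex.cell C (n + 1))}
      (hS : T.I (n + 1) = S) : Matrix.toEuclideanLin ((incidence o n).map (Int.cast : ℤ → ℝ) *
        Matrix.diagonal (fun b => if b ∈ S then (if b ∈ (whole C).I (n + 1) then
          Real.exp (-W b) else 0) else 0) *
        ((incidence o n).map (Int.cast : ℤ → ℝ)).transpose) = laplace o T W := by
    rw [laplace_eq_toEuclideanLin, hS]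
    simp [whole_I]
  rw [laplace_eq_toEuclideanLin, det_compression_eq_sum, finsum_eq_sum_of_fintype]
  symm
  -- Match a tree with its set of top cells; it remains to see that sets not arising from trees
  -- contribute zero.
  refine Finset.sum_of_injOn (fun T => (T.1.I (n + 1)).toFinset) ?_ ?_ ?_ ?_
  · intro T _ T' _ h
    refine Subtype.ext (subcomplex_ext_of_skeleton_subset hdim T.2.skeleton_subset
      T'.2.skeleton_subset (Set.toFinset_inj.1 h))
  · intro T _
    obtain ⟨h1, h2⟩ := (isSpanningTree_iff o hdim T.2.skeleton_subset).1 T.2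
    refine Finset.mem_coe.2 (Finset.mem_powersetCard.2 ⟨Finset.subset_univ _, ?_⟩)
    rw [hV, ← h2, range_treeBdry, finrank_span_eq_card h1, Set.toFinset_card]
  · intro S hS hS'
    have hI : (skeletonUnion n (S : Set (RelCWComplex.cell C (n + 1)))).I (n + 1) = S :=
      skeletonUnion_I _ _
    have hcard : Fintype.card ((skeletonUnion n
        (S : Set (RelCWComplex.cell C (n + 1)))).I (n + 1)) = Module.finrank ℝ V := by
      rw [← (Finset.mem_powersetCard.1 hS).2, ← Set.toFinset_card]
      congr 1
      ext; simp [hI]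
    rw [hcell _ hI]
    refine det_compression_eq_zero _ _ ?_
    -- If the rank were at least `dim V`, then, as `B_n(T; ℝ) ⊆ B_n(X; ℝ)`, the `dim V` boundaries
    -- of the cells in `S` would span a space of dimension `dim V`. They would be independent, and
    -- `S` would come from a tree.
    by_contra hle
    have hle' := (not_lt.1 hle).trans (Submodule.finrank_mono (range_laplace_le o _ W))
    have hge := Submodule.finrank_mono (range_treeBdry_le_whole (n := n) o
      (skeletonUnion n (S : Set (RelCWComplex.cell C (n + 1)))))
    rw [← hV] at hge
    have heq := le_antisymm hge hle'
    have htree : IsSpanningTree o n (skeletonUnion n (S : Set (RelCWComplex.cell C (n + 1)))) := by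
      refine (isSpanningTree_iff o hdim (skeleton_subset_skeletonUnion n _)).2
        ⟨?_, heq.trans hV⟩
      rw [linearIndependent_iff_card_eq_finrank_span, hcard, ← heq, range_treeBdry]
      rfl
    refine hS' ⟨⟨_, htree⟩, Finset.mem_coe.2 (Finset.mem_univ _), ?_⟩
    ext; simp [hI]
  · intro T _
    rw [hcell T.1 (by simp)]

lemma finrank_realSpan_of_projectionIntegral {A : Submodule ℤ (RelCWComplex.cell C n → ℤ)}
    (hA : ProjectionIntegral o A) :
    Module.finrank ℝ (realSpan A) =
      Module.finrank ℝ (LinearMap.range (treeBdry o n (whole C))) := by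
  obtain ⟨p, hp, -⟩ := hA
  rw [← realSpan_boundaries, finrank_realSpan, finrank_realSpan,
    ← Module.finrank_baseChange (R := ℝ) (S := ℤ) (M' := A),
    ← Module.finrank_baseChange (R := ℝ) (S := ℤ) (M' := boundaries ℤ o (whole C) n)]
  exact (LinearEquiv.ofBijective _ hp).finrank_eq.symm

lemma finite_isSpanningTree (hdim : HasDim C (n + 1)) :
    {T : CWComplex.Subcomplex C | IsSpanningTree o n T}.Finite := by
  have : Finite (Set (RelCWComplex.cell C (n + 1))) := inferInstance
  refine Set.Finite.of_injOn (f := fun T : CWComplex.Subcomplex C => T.I (n + 1))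
    (Set.mapsTo_univ _ _) ?_ (Set.finite_univ)
  exact fun T hT T' hT' h => subcomplex_ext_of_skeleton_subset hdim hT.skeleton_subset
    hT'.skeleton_subset h

end Operators

end CellTree

theorem mainTheorem9 {X : Type u} [TopologicalSpace X] [T2Space X] (C : Set X) [CWComplex C]
    [RelCWComplex.Finite C] (hconn : IsConnected C) (n : ℕ) (hdim : CellTree.HasDim C (n + 1))
    (o : CellTree.CellOrientation C) :
    {T : CWComplex.Subcomplex C | CellTree.IsSpanningTree o n T}.Finite ∧
    (∀ A : Submodule ℤ (RelCWComplex.cell C n → ℤ), CellTree.ProjectionIntegral o A →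
      ∀ W : RelCWComplex.cell C (n + 1) → ℝ,
        LinearMap.det (CellTree.opLA o A (CellTree.whole C) W) =
          ∑ᶠ T : {T : CWComplex.Subcomplex C // CellTree.IsSpanningTree o n T},
            LinearMap.det (CellTree.opLA o A T.1 W)) ∧
    (∀ W : RelCWComplex.cell C (n + 1) → ℝ,
      LinearMap.det (CellTree.opL o (CellTree.whole C) W) =
        ∑ᶠ T : {T : CWComplex.Subcomplex C // CellTree.IsSpanningTree o n T},
          LinearMap.det (CellTree.opL o T.1 W)) ∧
    ∑ᶠ T : {T : CWComplex.Subcomplex C // CellTree.IsSpanningTree o n T},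
        LinearMap.det (CellTree.opL o T.1 (0 : RelCWComplex.cell C (n + 1) → ℝ)) =
      ∑ᶠ T : {T : CWComplex.Subcomplex C // CellTree.IsSpanningTree o n T},
        (CellTree.mu (CellTree.boundaries ℤ o T.1 n) : ℝ) := by
  have hfin := CellTree.finite_isSpanningTree o hdim
  have htree (T : {T : CWComplex.Subcomplex C // CellTree.IsSpanningTree o n T}) :=
    (CellTree.isSpanningTree_iff o hdim T.2.skeleton_subset).1 T.2
  refine ⟨hfin, fun A hA W => CellTree.det_compression_laplace o hdim hfin W _
    (CellTree.finrank_realSpan_of_projectionIntegral o hA), fun W => ?_,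
    finsum_congr fun T => CellTree.det_opL_zero_eq_mu o (htree T).1⟩
  -- Here `V = B_n(X; ℝ)`; for a tree, inclusion and equal dimension give `B_n(T; ℝ) = V`, so each
  -- summand is the determinant of `ℒ^T` itself.
  rw [CellTree.opL_eq_compression, CellTree.det_compression_laplace o hdim hfin W _ rfl]
  refine finsum_congr fun T => ?_
  rw [CellTree.opL_eq_compression, Submodule.eq_of_le_of_finrank_eq
    (CellTree.range_treeBdry_le_whole o T.1) (htree T).2]
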